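/- Let $K=\mathbb{C}((t))$ with its $t$-adic topology, $\mathcal{O}_K=\mathbb{C}[[t]]$, and let $\mathcal{O}_K\langle x_1,\dots,x_n\rangle$ be the ring of power series $\sum_{i\in\mathbb{N}^n}a_ix^i$ with $a_i\in\mathcal{O}_K$ and $a_i\to0$ $t$-adically as $i_1+\dots+i_n\to\infty$. For $f\in\mathcal{O}_K\langle x_1,\dots,x_n\rangle$ let $f^|\colon K^n\to K$ be the function $z\mapsto f(z)$ on $\mathcal{O}_K^n$, extended by $0$ outside $\mathcal{O}_K^n$. The language of valued fields has symbols $+,-,\cdot,(\cdot)^{-1},|$, where $0^{-1}=0$ and $x|y$ means $x\neq0$ and $y/x\in\mathcal{O}_K$; the language $\mathcal{L}_{\rm an}^K$ is obtained by adding a function symbol for each $f^|$, $f\in\mathcal{O}_K\langle x_1,\dots,x_n\rangle$, $n\ge0$. A set is semi-algebraic if it is definable, with constants from $K$, in the language of valued fields, and a function is semi-algebraic if its graph is. The local dimension of a semi-algebraic set $C\subset K^n$ at $x\in C$ is the maximal integer $m\ge0$ such that for all sufficiently small semi-algebraic open neighbourhoods $U$ of $x$ there is a semi-algebraic function $U\cap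 C\to K^m$ whose range has nonempty interior in $K^m$. For $X\subset K^n$ let $X^{\rm alg}$ be the union of all semi-algebraic sets $C\subset X$ of constant local dimension $1$, and let $X^{\rm trans}=X\setminus X^{\rm alg}$. For $r\ge1$ let $\mathcal{O}_K(r)\subset\mathcal{O}_K$ be the set of polynomials in $t$ over $\mathbb{C}$ of degree less than $r$, and let $X(r)=X\cap\mathcal{O}_K(r)^n$. **Proposition.** For any sequence of positive integers $N_r$, $r>0$, there is an $\mathcal{L}_{\rm an}^K$-definable set $X\subset K^2$ such that $$N_r<\#\,(X^{\rm trans})(r)\qquad\text{for all } r>0.$$ Furthermore, $X$ can be taken to be the graph of a function $f\colon\mathcal{O}_K\to\mathcal{O}_K$ given by a power series in $\mathcal{O}_K\langle x\rangle$ in one variable $x$. -/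

import Mathlib

namespace LaurentCounting

noncomputable section

/-- The field `K = ℂ((t))` of formal Laurent series. It carries Mathlib's `t`-adic valuation
`Valued.v` and the `t`-adic topology. -/
abbrev K : Type := LaurentSeries ℂ

/-- The valuation ring `𝒪_K = ℂ[[t]]`, as a subring of `K`. -/
def OK : Subring K := (HahnSeries.ofPowerSeries ℤ ℂ).range

/-! ### Restricted power series and restricted analytic functions -/

/-- `𝒪_K⟨x₁, …, xₙ⟩`: the power series `∑ aᵢ xⁱ` over `𝒪_K = ℂ[[t]]` whose coefficients tend to
`0` `t`-adically as `i₁ + ⋯ + iₙ → ∞` (note that `|a| ≤ e⁻ᵐ` means `tᵐ ∣ a`). -/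
def RestrictedSeries (n : ℕ) : Type :=
  {f : MvPowerSeries (Fin n) (PowerSeries ℂ) //
    ∀ m : ℕ, ∃ d : ℕ, ∀ i : Fin n →₀ ℕ, d ≤ i.degree →
      (PowerSeries.X : PowerSeries ℂ) ^ m ∣ MvPowerSeries.coeff i f}

/-- The coefficient `aᵢ` of a restricted power series, as an element of `K`. -/
def RestrictedSeries.coeffK {n : ℕ} (f : RestrictedSeries n) (i : Fin n →₀ ℕ) : K :=
  HahnSeries.ofPowerSeries ℤ ℂ (MvPowerSeries.coeff i f.1)

open Classical in
/-- The restricted analytic function `Kⁿ → K` of `f ∈ 𝒪_K⟨x₁, …, xₙ⟩`: on `𝒪_Kⁿ` it is the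
`t`-adically convergent sum `∑ aᵢ zⁱ`, and it is `0` elsewhere. -/
def RestrictedSeries.fn {n : ℕ} (f : RestrictedSeries n) (z : Fin n → K) : K :=
  if ∀ j, z j ∈ OK then ∑' i : Fin n →₀ ℕ, f.coeffK i * ∏ j, z j ^ i j else 0

/-! ### The languages -/

/-- The function symbols `+`, `-`, `·`, `(·)⁻¹` of the language of valued fields. -/
inductive ValuedFieldFunc : ℕ → Type
  | add : ValuedFieldFunc 2
  | sub : ValuedFieldFunc 2
  | mul : ValuedFieldFunc 2
  | inv : ValuedFieldFunc 1

/-- The relation symbol `∣` of the language of valued fields. -/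
inductive ValuedFieldRel : ℕ → Type
  | dvd : ValuedFieldRel 2

/-- The language of valued fields, with symbols `+`, `-`, `·`, `(·)⁻¹`, `∣`. -/
abbrev valuedFieldLang : FirstOrder.Language.{0, 0} := ⟨ValuedFieldFunc, ValuedFieldRel⟩

/-- `K` as a valued field: `0⁻¹ = 0`, and `x ∣ y` holds iff `x ≠ 0` and `y / x ∈ 𝒪_K`. -/
instance : valuedFieldLang.Structure K where
  funMap f v := match f, v with
    | ValuedFieldFunc.add, v => v 0 + v 1
    | ValuedFieldFunc.sub, v => v 0 - v 1
    | ValuedFieldFunc.mul, v => v 0 * v 1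
    | ValuedFieldFunc.inv, v => (v 0)⁻¹
  RelMap R v := match R, v with
    | ValuedFieldRel.dvd, v => v 0 ≠ 0 ∧ v 1 / v 0 ∈ OK

/-- One `n`-ary function symbol for each element of `𝒪_K⟨x₁, …, xₙ⟩`, for every `n ≥ 0`. -/
abbrev restrictedLang : FirstOrder.Language.{0, 0} := ⟨RestrictedSeries, fun _ => Empty⟩

instance : restrictedLang.Structure K where
  funMap f v := RestrictedSeries.fn f v
  RelMap R := R.elim

/-- The analytic language: the language of valued fields together with a symbol for each
restricted analytic function. -/
abbrev analyticLang : FirstOrder.Language.{0, 0} := valuedFieldLang.sum restrictedLang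

/-- Definability in the analytic language. No parameters need to be added: each element of `𝒪_K`
is (the value of) a `0`-ary symbol, so each element of `K` is the value of a closed term. -/
def IsAnalyticDefinable {n : ℕ} (X : Set (Fin n → K)) : Prop :=
  (∅ : Set K).Definable analyticLang X

/-- Semi-algebraic sets: definable, with constants from `K`, in the language of valued fields. -/
def IsSemialgebraic {ι : Type} (C : Set (ι → K)) : Prop :=
  (Set.univ : Set K).Definable valuedFieldLang C

/-- `g`, restricted to `S`, is a semi-algebraic function `S → Kᵐ`: its graph is semi-algebraic. -/
def IsSemialgebraicFun {n m : ℕ} (S : Set (Fin n → K)) (g : S → (Fin m → K)) : Prop :=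
  IsSemialgebraic {p : Fin n ⊕ Fin m → K |
    ∃ x : S, (∀ i, p (Sum.inl i) = x.1 i) ∧ ∀ j, p (Sum.inr j) = g x j}

/-! ### Local dimension, algebraic and transcendental part -/

/-- For all sufficiently small semi-algebraic open neighbourhoods `U` of `x` there is a
semi-algebraic function `U ∩ C → Kᵐ` whose range has nonempty interior. -/
def HasLocalImages {n : ℕ} (C : Set (Fin n → K)) (x : Fin n → K) (m : ℕ) : Prop :=
  ∃ U₀ : Set (Fin n → K), IsOpen U₀ ∧ x ∈ U₀ ∧ IsSemialgebraic U₀ ∧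
    ∀ U ⊆ U₀, IsOpen U → x ∈ U → IsSemialgebraic U →
      ∃ g : ↥(U ∩ C) → (Fin m → K), IsSemialgebraicFun (U ∩ C) g ∧
        (interior (Set.range g)).Nonempty

/-- `C` has local dimension `d` at `x`: `d` is the largest `m` with the above property. -/
def HasLocalDim {n : ℕ} (C : Set (Fin n → K)) (x : Fin n → K) (d : ℕ) : Prop :=
  IsGreatest {m : ℕ | HasLocalImages C x m} d

/-- `X^alg`: the union of all semi-algebraic `C ⊆ X` of constant local dimension `1`. -/
def algPart {n : ℕ} (X : Set (Fin n → K)) : Set (Fin n → K) :=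
  ⋃₀ {C | C ⊆ X ∧ IsSemialgebraic C ∧ ∀ x ∈ C, HasLocalDim C x 1}

/-- `X^trans = X \ X^alg`. -/
def transPart {n : ℕ} (X : Set (Fin n → K)) : Set (Fin n → K) := X \ algPart X

/-! ### Points of bounded height -/

/-- `𝒪_K(r)`: the polynomials in `t` over `ℂ` of degree less than `r`, as elements of `K`. -/
def polyLT (r : ℕ) : Set K :=
  {x | ∃ p : Polynomial ℂ, p.degree < r ∧ x = HahnSeries.ofPowerSeries ℤ ℂ (p : PowerSeries ℂ)}

/-- `X(r) = X ∩ 𝒪_K(r)ⁿ`. -/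
def pointsLT {n : ℕ} (X : Set (Fin n → K)) (r : ℕ) : Set (Fin n → K) :=
  {v ∈ X | ∀ i, v i ∈ polyLT r}

end

end LaurentCounting

/-! Take `f = ∑ n, c n * t ^ n * (x)_(deg n)`, with falling factorials `(x)_k`, algebraically
independent `c n ∈ ℂ`, and `deg` strictly increasing with `N r < deg r`. At a natural number `s <
deg r` every term with `n ≥ r` vanishes, so `f s` is a polynomial in `t` of degree less than `r`.
This gives `deg r` points on the graph `X`, and it remains to see that `X^alg` is empty.

A semi-algebraic `C ⊆ X` uses finitely many constants, hence is preserved by every automorphism `σ`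
of `ℂ⟦t⟧` fixing a finite set `S`. If also `σ t = t`, then `(z, f z) ∈ C` gives `f (σ z) = σ (f z) =
f^σ (σ z)`, where `f^σ` has the coefficients of `f` moved by `σ`. If `f^σ ≠ f`, Strassmann's theorem
(`finite_zeros_of_coeffsTendToZero`) leaves finitely many `z`, so `C` is finite and cannot have
local dimension 1 anywhere.

Such a `σ` is `exp D` with `D = t * ∑ l m * d m`, where the derivations `d m` are dual to the `c n`
and the `l m` solve the linear system `D x = 0` for `x ∈ S` (`exists_ringEquiv_fixing_ne`). The
factor `t` makes the exponential converge, and `exp D` fixes exactly the kernel of `D`. -/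

open PowerSeries Finset

/-! ### Derivations of `ℂ` dual to algebraically independent numbers -/

/-- A derivation dual to a sequence of algebraically independent complex numbers. -/
theorem exists_dual_derivations : ∃ (c : ℕ → ℂ) (d : ℕ → Derivation ℚ ℂ ℂ),
    ∀ m k, d m (c k) = if m = k then 1 else 0 := by
  obtain ⟨s, hs⟩ := exists_isTranscendenceBasis ℚ ℂ
  have hinf : Infinite s := by
    have h := IsAlgClosed.cardinal_eq_cardinal_transcendence_basis_of_aleph0_lt' _ hs
      (by simp) (by rw [Cardinal.mk_complex]; exact Cardinal.aleph0_lt_continuum)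
    rw [Cardinal.infinite_iff, ← h, Cardinal.mk_complex]
    exact Cardinal.aleph0_le_continuum
  let : Algebra (MvPolynomial s ℚ) ℂ :=
    (MvPolynomial.aeval (R := ℚ) ((↑) : s → ℂ)).toRingHom.toAlgebra
  have halg (x : MvPolynomial s ℚ) : algebraMap (MvPolynomial s ℚ) ℂ x =
    MvPolynomial.aeval (R := ℚ) ((↑) : s → ℂ) x := rfl
  have : IsScalarTower ℚ (MvPolynomial s ℚ) ℂ := IsScalarTower.of_algebraMap_eq fun q => by
    rw [halg, AlgHom.commutes]
  have : FaithfulSMul (MvPolynomial s ℚ) ℂ :=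
    (faithfulSMul_iff_algebraMap_injective _ _).2 hs.1
  have hA : Algebra.IsAlgebraic (MvPolynomial s ℚ) ℂ := by
    have := hs.isAlgebraic
    refine (Algebra.isAlgebraic_ringHom_iff_of_comp_eq (hs.1.aevalEquiv) (RingEquiv.refl ℂ) ?_).1 this
    ext x <;> simp [halg]
  -- A localization followed by an algebraic, hence (characteristic 0) separable, extension is
  -- formally étale. So the differentials of the transcendence basis form a `ℂ`-basis of the Kähler
  -- differentials of `ℂ`, and its coordinate functions give the derivations.
  have : Algebra.FormallyEtale (MvPolynomial s ℚ) ℂ := by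
    let : Algebra (FractionRing (MvPolynomial s ℚ)) ℂ := FractionRing.liftAlgebra _ _
    have := FractionRing.isScalarTower_liftAlgebra (MvPolynomial s ℚ) ℂ
    have : Algebra.IsAlgebraic (FractionRing (MvPolynomial s ℚ)) ℂ :=
      (IsFractionRing.comap_isAlgebraic_iff (A := MvPolynomial s ℚ)).1 hA
    have : Algebra.FormallyEtale (MvPolynomial s ℚ) (FractionRing (MvPolynomial s ℚ)) :=
      .of_isLocalization (nonZeroDivisors _)
    have : Algebra.FormallyEtale (FractionRing (MvPolynomial s ℚ)) ℂ := .of_isSeparable _ _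
    exact .comp _ (FractionRing (MvPolynomial s ℚ)) _
  let b := (KaehlerDifferential.mvPolynomialBasis ℚ s).baseChange ℂ
  let e := (KaehlerDifferential.tensorKaehlerEquivOfFormallyEtale ℚ (MvPolynomial s ℚ) ℂ).symm
  let i := Infinite.natEmbedding s
  refine ⟨fun k => i k, fun m => ((b.coord (i m)).comp e.toLinearMap).compDer
    (KaehlerDifferential.D ℚ ℂ), fun m k => ?_⟩
  have h := KaehlerDifferential.tensorKaehlerEquivOfFormallyEtale_symm_D_algebraMap ℚ
    (MvPolynomial s ℚ) ℂ (MvPolynomial.X (i k))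
  rw [halg, MvPolynomial.aeval_X] at h
  change b.coord (i m) (e (KaehlerDifferential.D ℚ ℂ (i k))) = _
  rw [h]
  rw [← KaehlerDifferential.mvPolynomialBasis_apply, ← Module.Basis.baseChange_apply]
  simp [b, Finsupp.single_apply, eq_comm]

/-! ### Coefficientwise derivations and `X`-adic separatedness -/

namespace PowerSeries

/-- The coefficientwise extension of a derivation to power series. -/
noncomputable def coeffDerivation {R : Type*} [CommRing R] [Algebra ℚ R]
    (d : Derivation ℚ R R) : Derivation ℚ R⟦X⟧ R⟦X⟧ :=
  Derivation.mk'
    { toFun := fun f => mk fun n => d (coeff n f)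
      map_add' := fun f g => by ext n; simp
      map_smul' := fun q f => by ext n; simp }
    fun f g => by
      ext n
      simp only [LinearMap.coe_mk, AddHom.coe_mk, coeff_mk, coeff_mul, map_sum, smul_eq_mul,
        map_add, Derivation.leibniz, Finset.sum_add_distrib]
      congr 1
      rw [← Finset.Nat.sum_antidiagonal_swap]
      simp

@[simp] theorem coeff_coeffDerivation {R : Type*} [CommRing R] [Algebra ℚ R]
    (d : Derivation ℚ R R) (f : R⟦X⟧) (n : ℕ) :
    coeff n (coeffDerivation d f) = d (coeff n f) := by
  simp [coeffDerivation]

@[simp] theorem coeffDerivation_X {R : Type*} [CommRing R] [Algebra ℚ R]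
    (d : Derivation ℚ R R) : coeffDerivation d X = 0 := by
  ext n
  rw [coeff_coeffDerivation, coeff_X]
  split_ifs <;> simp

theorem eq_zero_of_forall_X_pow_dvd {R : Type*} [CommRing R] {f : R⟦X⟧}
    (h : ∀ n : ℕ, X ^ n ∣ f) : f = 0 := by
  ext n
  exact X_pow_dvd_iff.1 (h (n + 1)) n n.lt_succ_self

theorem eq_of_forall_X_pow_dvd_sub {R : Type*} [CommRing R] {f g : R⟦X⟧}
    (h : ∀ n : ℕ, X ^ n ∣ f - g) : f = g :=
  sub_eq_zero.1 (eq_zero_of_forall_X_pow_dvd h)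

end PowerSeries

/-- Terms of total degree at least `n` do not matter modulo `t ^ n`. -/
theorem pow_dvd_sum_range_sub_sum_antidiagonal {A : Type*} [CommRing A] {t : A} {g : ℕ → ℕ → A}
    (hg : ∀ i j, t ^ (i + j) ∣ g i j) (n : ℕ) :
    t ^ n ∣ ∑ i ∈ range n, ∑ j ∈ range n, g i j -
      ∑ s ∈ range n, ∑ p ∈ antidiagonal s, g p.1 p.2 := by
  have h : ∑ s ∈ range n, ∑ p ∈ antidiagonal s, g p.1 p.2 =
      ∑ i ∈ range n, ∑ j ∈ range (n - i), g i j := by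
    rw [← Finset.sum_range_diag_flip]
    exact Finset.sum_congr rfl fun s _ => Finset.Nat.sum_antidiagonal_eq_sum_range_succ g s
  rw [h, ← Finset.sum_sub_distrib]
  refine Finset.dvd_sum fun i _ => ?_
  rw [← Finset.sum_sdiff (Finset.range_subset_range.2 (Nat.sub_le n i)), add_sub_cancel_right]
  refine Finset.dvd_sum fun j hj => (pow_dvd_pow t ?_).trans (hg i j)
  simp only [mem_sdiff, mem_range] at hj
  omega

/-! ### Truncated exponentials of a derivation raising the `t`-adic order -/

namespace Derivation

variable {A : Type*} [CommRing A] [Algebra ℚ A]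

theorem iterate_mul (D : Derivation ℚ A A) (n : ℕ) (x y : A) :
    D^[n] (x * y) =
      ∑ p ∈ antidiagonal n, (n.choose p.1 : A) * (D^[p.1] x * D^[p.2] y) := by
  induction n with
  | zero => simp
  | succ n ih =>
    rw [sum_antidiagonal_choose_succ_mul (fun i j => D^[i] x * D^[j] y), Function.iterate_succ_apply',
      ih, map_sum, ← Finset.sum_add_distrib]
    refine Finset.sum_congr rfl fun p hp => ?_
    rw [← (mem_antidiagonal.1 hp), Nat.choose_symm_add, Function.iterate_succ_apply',
      Function.iterate_succ_apply']
    simp only [Derivation.leibniz, smul_eq_mul, map_natCast, mul_zero, add_zero]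
    ring

/-- The truncated exponential of a derivation. -/
noncomputable def expTrunc (D : Derivation ℚ A A) (n : ℕ) : A →ₗ[ℚ] A :=
  ∑ k ∈ range n, (k.factorial : ℚ)⁻¹ • (D : A →ₗ[ℚ] A) ^ k

theorem expTrunc_apply (D : Derivation ℚ A A) (n : ℕ) (x : A) :
    D.expTrunc n x = ∑ k ∈ range n, (k.factorial : ℚ)⁻¹ • D^[k] x := by
  simp [expTrunc, LinearMap.sum_apply, Module.End.pow_apply]

section

variable {D : Derivation ℚ A A} {t : A} (hD : ∀ n x, t ^ n ∣ x → t ^ (n + 1) ∣ D x)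
include hD

theorem pow_dvd_iterate {n : ℕ} {x : A} (hx : t ^ n ∣ x) (k : ℕ) : t ^ (n + k) ∣ D^[k] x := by
  induction k with
  | zero => simpa
  | succ k ih =>
    rw [Function.iterate_succ_apply']
    exact hD _ _ ih

theorem pow_dvd_iterate' (x : A) (k : ℕ) : t ^ k ∣ D^[k] x := by
  simpa using pow_dvd_iterate hD (n := 0) (x := x) (by simp) k

theorem pow_dvd_expTrunc {n : ℕ} {x : A} (hx : t ^ n ∣ x) (m : ℕ) :
    t ^ n ∣ D.expTrunc m x := by
  rw [expTrunc_apply]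
  exact Finset.dvd_sum fun k _ => dvd_smul_of_dvd _
    ((pow_dvd_pow t (Nat.le_add_right n k)).trans (pow_dvd_iterate hD hx k))

theorem pow_dvd_expTrunc_sub {n m : ℕ} (h : n ≤ m) (x : A) :
    t ^ n ∣ D.expTrunc m x - D.expTrunc n x := by
  rw [expTrunc_apply, expTrunc_apply, ← Finset.sum_sdiff (Finset.range_subset_range.2 h),
    add_sub_cancel_right]
  refine Finset.dvd_sum fun k hk => dvd_smul_of_dvd _ ((pow_dvd_pow t ?_).trans
    (pow_dvd_iterate' hD x k))
  simp only [mem_sdiff, mem_range] at hk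
  omega

/-- By Leibniz, the truncation at `x * y` sums the products of terms over `i + j < n`; the other
products have `i + j ≥ n` and are divisible by `t ^ n`. -/
theorem pow_dvd_expTrunc_mul (n : ℕ) (x y : A) :
    t ^ n ∣ D.expTrunc n x * D.expTrunc n y - D.expTrunc n (x * y) := by
  have h := pow_dvd_sum_range_sub_sum_antidiagonal (t := t) (g := fun i j =>
    ((i.factorial : ℚ)⁻¹ • D^[i] x) * ((j.factorial : ℚ)⁻¹ • D^[j] y))
    (fun i j => by
      rw [pow_add]
      exact mul_dvd_mul (dvd_smul_of_dvd _ (pow_dvd_iterate' hD x i))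
        (dvd_smul_of_dvd _ (pow_dvd_iterate' hD y j))) n
  simp only [expTrunc_apply, Finset.sum_mul_sum]
  convert h using 3 with s
  rw [iterate_mul, Finset.smul_sum]
  refine Finset.sum_congr rfl fun p hp => ?_
  rw [smul_mul_smul_comm, ← nsmul_eq_mul, ← Nat.cast_smul_eq_nsmul ℚ, smul_smul]
  congr 1
  rw [← mem_antidiagonal.1 hp, Nat.cast_add_choose]
  field_simp

theorem pow_dvd_expTrunc_neg (n : ℕ) (x : A) :
    t ^ n ∣ D.expTrunc n ((-D).expTrunc n x) - x := by
  cases n with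
  | zero => simp
  | succ n =>
  have hneg (k : ℕ) (x : A) : (-D)^[k] x = (-1 : ℚ) ^ k • D^[k] x := by
    induction k with
    | zero => simp
    | succ k ih =>
      rw [Function.iterate_succ_apply', ih, Function.iterate_succ_apply', Derivation.map_smul,
        Derivation.neg_apply, pow_succ, mul_smul]
      simp
  have h := pow_dvd_sum_range_sub_sum_antidiagonal (t := t) (g := fun i j =>
    ((i.factorial : ℚ)⁻¹ * ((j.factorial : ℚ)⁻¹ * (-1) ^ j)) • D^[i + j] x)
    (fun i j => dvd_smul_of_dvd _ (pow_dvd_iterate' hD x _)) (n + 1)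
  have h1 (s : ℕ) : ∑ p ∈ antidiagonal s,
      ((p.1.factorial : ℚ)⁻¹ * ((p.2.factorial : ℚ)⁻¹ * (-1) ^ p.2)) • D^[p.1 + p.2] x =
      if s = 0 then x else 0 := by
    -- The coefficients of `D^[s] x` collected here are those of `exp(u) * exp(-u) = 1`.
    have h2 := congrArg (PowerSeries.coeff s) (PowerSeries.exp_mul_exp_neg_eq_one (A := ℚ))
    rw [PowerSeries.coeff_mul, PowerSeries.coeff_one] at h2
    rw [Finset.sum_congr rfl (g := fun p =>
      ((p.1.factorial : ℚ)⁻¹ * ((p.2.factorial : ℚ)⁻¹ * (-1) ^ p.2)) • D^[s] x)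
      fun p hp => by rw [mem_antidiagonal.1 hp], ← Finset.sum_smul]
    have h3 : ∑ p ∈ antidiagonal s,
        ((p.1.factorial : ℚ)⁻¹ * ((p.2.factorial : ℚ)⁻¹ * (-1) ^ p.2)) =
        if s = 0 then 1 else 0 := by
      rw [← h2]
      refine Finset.sum_congr rfl fun p _ => ?_
      simp [PowerSeries.coeff_exp, evalNegHom, coeff_rescale, mul_comm]
    rw [h3]
    split_ifs with hs <;> simp [hs]
  simp only [h1, Finset.sum_ite_eq', mem_range, Nat.succ_pos, if_true] at h
  convert h using 2
  rw [expTrunc_apply]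
  refine Finset.sum_congr rfl fun i _ => ?_
  have h4 : D^[i] ((-D).expTrunc (n + 1) x) =
      ∑ j ∈ range (n + 1), ((j.factorial : ℚ)⁻¹ * (-1) ^ j) • D^[i + j] x := by
    rw [expTrunc_apply, ← Derivation.coeFn_coe, ← Module.End.pow_apply, map_sum]
    refine Finset.sum_congr rfl fun j _ => ?_
    rw [hneg, smul_smul, LinearMap.map_smul, Module.End.pow_apply, Function.iterate_add_apply]
    rfl
  rw [h4, Finset.smul_sum]
  simp only [smul_smul]

end

end Derivation

/-! ### The exponential automorphism and its fixed points -/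

namespace PowerSeries

open Derivation

variable {R : Type*} [CommRing R] [Algebra ℚ R]

/-- The exponential of a derivation that raises the order of power series. -/
noncomputable def expDerivation (D : Derivation ℚ R⟦X⟧ R⟦X⟧) (x : R⟦X⟧) : R⟦X⟧ :=
  mk fun n => coeff n (D.expTrunc (n + 1) x)

section

variable {D : Derivation ℚ R⟦X⟧ R⟦X⟧} (hD : ∀ n x, X ^ n ∣ x → X ^ (n + 1) ∣ D x)
include hD

theorem X_pow_dvd_expDerivation_sub (n : ℕ) (x : R⟦X⟧) :
    X ^ n ∣ expDerivation D x - D.expTrunc n x := by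
  refine X_pow_dvd_iff.2 fun m hm => ?_
  have h := X_pow_dvd_iff.1 (pow_dvd_expTrunc_sub hD (Nat.succ_le_of_lt hm) x) m m.lt_succ_self
  rw [map_sub, sub_eq_zero] at h ⊢
  rw [h, expDerivation, coeff_mk]

theorem expDerivation_mul (x y : R⟦X⟧) :
    expDerivation D (x * y) = expDerivation D x * expDerivation D y := by
  refine eq_of_forall_X_pow_dvd_sub fun n => ?_
  have h1 := X_pow_dvd_expDerivation_sub hD n (x * y)
  have h2 := (X_pow_dvd_expDerivation_sub hD n x).mul_right (expDerivation D y)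
  have h3 := (X_pow_dvd_expDerivation_sub hD n y).mul_left (D.expTrunc n x)
  have h4 := pow_dvd_expTrunc_mul hD n x y
  convert ((h1.sub h2).sub h3).sub h4 using 1
  ring

omit hD in
theorem expDerivation_add (x y : R⟦X⟧) :
    expDerivation D (x + y) = expDerivation D x + expDerivation D y := by
  ext n
  simp [expDerivation]

theorem expDerivation_neg (x : R⟦X⟧) : expDerivation D (expDerivation (-D) x) = x := by
  refine eq_of_forall_X_pow_dvd_sub fun n => ?_
  have hD' : ∀ n x, X ^ n ∣ x → X ^ (n + 1) ∣ (-D) x := fun n x h => by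
    simpa using hD n x h
  have h1 := X_pow_dvd_expDerivation_sub hD n (expDerivation (-D) x)
  have h2 := pow_dvd_expTrunc hD (X_pow_dvd_expDerivation_sub hD' n x) n
  rw [map_sub] at h2
  convert (h1.add h2).add (pow_dvd_expTrunc_neg hD n x) using 1
  ring

/-- The exponential of a derivation that raises the order of power series, as an automorphism. -/
noncomputable def expDerivationEquiv : R⟦X⟧ ≃+* R⟦X⟧ where
  toFun := expDerivation D
  invFun := expDerivation (-D)
  left_inv x := by
    have hD' : ∀ n x, X ^ n ∣ x → X ^ (n + 1) ∣ (-D) x := fun n x h => by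
      simpa using hD n x h
    simpa using expDerivation_neg hD' x
  right_inv x := expDerivation_neg hD x
  map_mul' := expDerivation_mul hD
  map_add' := expDerivation_add

omit hD in
theorem expDerivation_eq_self {x : R⟦X⟧} (hx : D x = 0) : expDerivation D x = x := by
  ext n
  rw [expDerivation, coeff_mk, expTrunc_apply, Finset.sum_range_succ',
    Finset.sum_eq_zero fun k _ => ?_]
  · simp
  · rw [Function.iterate_succ_apply, hx, Function.iterate_fixed (map_zero D), smul_zero]

/-- From `exp D x = x`, `D x` is minus the sum of the terms of order at least 2. If `X ^ n ∣ D x`,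
these are divisible by `X ^ (n + 1)`, hence so is `D x`; iterate. -/
theorem derivation_eq_zero_of_expDerivation_eq_self {x : R⟦X⟧} (hx : expDerivation D x = x) :
    D x = 0 := by
  refine eq_zero_of_forall_X_pow_dvd fun n => ?_
  induction n with
  | zero => simp
  | succ n ih =>
    -- The extra 2 lets the terms of order 0 and 1 be split off.
    have h := X_pow_dvd_expDerivation_sub hD (n + 1 + 2) x
    rw [hx, expTrunc_apply, Finset.sum_range_succ', Finset.sum_range_succ'] at h
    simp only [Function.iterate_succ_apply, Function.iterate_zero_apply, Nat.factorial] at h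
    have h2 : X ^ (n + 1) ∣ ∑ k ∈ range (n + 1),
        (((k + 1 + 1) * ((k + 1) * k.factorial) : ℕ) : ℚ)⁻¹ • D^[k] (D (D x)) :=
      Finset.dvd_sum fun k _ => dvd_smul_of_dvd _
        ((pow_dvd_pow X (Nat.le_add_right (n + 1) k)).trans (pow_dvd_iterate hD (hD _ _ ih) k))
    convert (((pow_dvd_pow X (Nat.le_add_right (n + 1) 2)).trans h).add h2).neg_right using 1
    simp

end

end PowerSeries

/-! ### Convergent power series over `R⟦X⟧` and Strassmann's theorem -/

namespace PowerSeries

variable {R : Type*} [CommRing R]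

/-- The coefficients `b i` tend to `0` in the `X`-adic topology. -/
def CoeffsTendToZero (b : ℕ → R⟦X⟧) : Prop := ∀ m : ℕ, ∃ d : ℕ, ∀ i, d ≤ i → X ^ m ∣ b i

/-- The series `∑ b i * z ^ i` converges to `y` in the `X`-adic topology. -/
def EvalsTo (b : ℕ → R⟦X⟧) (z y : R⟦X⟧) : Prop :=
  ∀ m : ℕ, ∃ d₀ : ℕ, ∀ d, d₀ ≤ d → X ^ m ∣ y - ∑ i ∈ range d, b i * z ^ i

theorem dvd_sum_range_sub_sum_range {A : Type*} [CommRing A] {g : ℕ → A} {a : A} {d e : ℕ}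
    (hg : ∀ i, d ≤ i → a ∣ g i) (hde : d ≤ e) : a ∣ ∑ i ∈ range e, g i - ∑ i ∈ range d, g i := by
  rw [← Finset.sum_sdiff (Finset.range_subset_range.2 hde), add_sub_cancel_right]
  refine Finset.dvd_sum fun i hi => hg i ?_
  simpa using (Finset.mem_sdiff.1 hi).2

theorem CoeffsTendToZero.exists_evalsTo {b : ℕ → R⟦X⟧} (hb : CoeffsTendToZero b) (z : R⟦X⟧) :
    ∃ y, EvalsTo b z y := by
  choose e he using hb
  refine ⟨mk fun n => coeff n (∑ i ∈ range (e (n + 1)), b i * z ^ i), fun m => ⟨e m, fun d hd =>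
    X_pow_dvd_iff.2 fun n hn => ?_⟩⟩
  have h1 : X ^ (n + 1) ∣ ∑ i ∈ range (max d (e (n + 1))), b i * z ^ i -
      ∑ i ∈ range d, b i * z ^ i :=
    dvd_sum_range_sub_sum_range (fun i hi => ((pow_dvd_pow X hn).trans
      (he m i (hd.trans hi))).mul_right _) (le_max_left _ _)
  have h2 : X ^ (n + 1) ∣ ∑ i ∈ range (max d (e (n + 1))), b i * z ^ i -
      ∑ i ∈ range (e (n + 1)), b i * z ^ i :=
    dvd_sum_range_sub_sum_range (fun i hi => (he _ i hi).mul_right _) (le_max_right _ _)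
  have h := X_pow_dvd_iff.1 (h1.sub h2) n n.lt_succ_self
  rw [sub_sub_sub_cancel_left, map_sub] at h
  rw [map_sub, coeff_mk, h]

theorem EvalsTo.sub {b b' : ℕ → R⟦X⟧} {z y y' : R⟦X⟧} (h : EvalsTo b z y)
    (h' : EvalsTo b' z y') : EvalsTo (fun i => b i - b' i) z (y - y') := by
  intro m
  obtain ⟨d, hd⟩ := h m
  obtain ⟨d', hd'⟩ := h' m
  refine ⟨max d d', fun e he => ?_⟩
  convert (hd e (le_of_max_le_left he)).sub (hd' e (le_of_max_le_right he)) using 1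
  simp only [sub_mul, Finset.sum_sub_distrib]
  ring

theorem CoeffsTendToZero.sub {b b' : ℕ → R⟦X⟧} (h : CoeffsTendToZero b)
    (h' : CoeffsTendToZero b') : CoeffsTendToZero fun i => b i - b' i := by
  intro m
  obtain ⟨d, hd⟩ := h m
  obtain ⟨d', hd'⟩ := h' m
  exact ⟨max d d', fun e he =>
    (hd e (le_of_max_le_left he)).sub (hd' e (le_of_max_le_right he))⟩

/-- An automorphism fixing `X` preserves divisibility by `X ^ m`, so it is `X`-adically continuous
and commutes with limits. -/
theorem EvalsTo.map {b : ℕ → R⟦X⟧} {z y : R⟦X⟧} (h : EvalsTo b z y) (σ : R⟦X⟧ ≃+* R⟦X⟧)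
    (hσ : σ X = X) : EvalsTo (fun i => σ (b i)) (σ z) (σ y) := by
  intro m
  obtain ⟨d, hd⟩ := h m
  refine ⟨d, fun e he => ?_⟩
  simpa [hσ] using map_dvd σ (hd e he)

theorem CoeffsTendToZero.map {b : ℕ → R⟦X⟧} (h : CoeffsTendToZero b) (σ : R⟦X⟧ ≃+* R⟦X⟧)
    (hσ : σ X = X) : CoeffsTendToZero fun i => σ (b i) := by
  intro m
  obtain ⟨d, hd⟩ := h m
  exact ⟨d, fun e he => by simpa [hσ] using map_dvd σ (hd e he)⟩

theorem CoeffsTendToZero.shift {b : ℕ → R⟦X⟧} (h : CoeffsTendToZero b) (j : ℕ) :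
    CoeffsTendToZero fun i => b (j + i) := by
  intro m
  obtain ⟨d, hd⟩ := h m
  exact ⟨d, fun e he => hd _ (he.trans (Nat.le_add_left e j))⟩

theorem EvalsTo.dvd {b : ℕ → R⟦X⟧} {z y : R⟦X⟧} (h : EvalsTo b z y) {m : ℕ}
    (hb : ∀ i, X ^ m ∣ b i) : X ^ m ∣ y := by
  obtain ⟨d, hd⟩ := h m
  have h1 := (hd d le_rfl).add
    (Finset.dvd_sum (s := range d) fun i _ => (hb i).mul_right (z ^ i))
  simpa using h1

theorem EvalsTo.eq_add {b : ℕ → R⟦X⟧} {z y y' : R⟦X⟧} (h : EvalsTo b z y)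
    (h' : EvalsTo (fun i => b (1 + i)) z y') : y = b 0 + z * y' := by
  refine eq_of_forall_X_pow_dvd_sub fun m => ?_
  obtain ⟨d, hd⟩ := h m
  obtain ⟨d', hd'⟩ := h' m
  convert (hd (max d d' + 1) (by omega)).sub ((hd' (max d d') (by omega)).mul_left z) using 1
  rw [Finset.sum_range_succ', mul_sub, Finset.mul_sum]
  have : ∑ k ∈ range (max d d'), b (k + 1) * z ^ (k + 1) =
      ∑ k ∈ range (max d d'), z * (b (1 + k) * z ^ k) :=
    Finset.sum_congr rfl fun k _ => by rw [add_comm 1 k]; ring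
  rw [this]
  ring

/-- Dividing a convergent power series by `x - z`: the quotient has the coefficients
`g j = ∑ i, b (j + 1 + i) * z ^ i`. -/
theorem EvalsTo.sub_eq_mul {b g : ℕ → R⟦X⟧} {z w y y' u : R⟦X⟧}
    (hz : EvalsTo b z y) (hw : EvalsTo b w y')
    (hg : ∀ j, EvalsTo (fun i => b (j + 1 + i)) z (g j)) (hu : EvalsTo g w u)
    (hg0 : CoeffsTendToZero g) : y' - y = (w - z) * u := by
  have hrec (j : ℕ) : g j = b (j + 1) + z * g (j + 1) :=
    (hg j).eq_add (by simpa only [← add_assoc] using hg (j + 1))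
  have hy : y = b 0 + z * g 0 := hz.eq_add (by simpa using hg 0)
  have hsum (d : ℕ) : ∑ j ∈ range (d + 1), b j * w ^ j - y =
      (w - z) * (∑ j ∈ range d, g j * w ^ j) - z * g d * w ^ d := by
    induction d with
    | zero => rw [hy]; simp
    | succ d ih =>
      rw [Finset.sum_range_succ, add_sub_right_comm, ih, Finset.sum_range_succ _ d, hrec d]
      ring
  refine eq_of_forall_X_pow_dvd_sub fun m => ?_
  obtain ⟨d₁, h₁⟩ := hw m
  obtain ⟨d₂, h₂⟩ := hu m
  obtain ⟨d₃, h₃⟩ := hg0 m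
  let d := max d₁ (max d₂ d₃)
  have h₁' := h₁ (d + 1) (by omega)
  have h₂' := (h₂ d (by omega)).mul_left (w - z)
  have h₃' := ((h₃ d (by omega)).mul_left z).mul_right (w ^ d)
  convert (h₁'.sub h₂').sub h₃' using 1
  linear_combination hsum d

/-- Strassmann's theorem. -/
theorem finite_zeros_of_coeffsTendToZero [IsDomain R] {b : ℕ → R⟦X⟧} (hb : CoeffsTendToZero b)
    (hb0 : ∃ i, b i ≠ 0) : {z | EvalsTo b z 0}.Finite := by
  -- Here `v` is the least order of a coefficient and `n` the last index attaining it. The induction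
  -- is on `n`, dividing by `x - z` at each zero `z`.
  suffices H : ∀ (n v : ℕ) (b : ℕ → R⟦X⟧), CoeffsTendToZero b → (∀ i, X ^ v ∣ b i) →
      ¬ X ^ (v + 1) ∣ b n → (∀ i, n < i → X ^ (v + 1) ∣ b i) → {z | EvalsTo b z 0}.Finite by
    obtain ⟨i₀, hi₀⟩ := hb0
    have hex : ∃ v, ∃ i, ¬ X ^ (v + 1) ∣ b i := by
      by_contra! h
      refine hi₀ (eq_zero_of_forall_X_pow_dvd fun m => ?_)
      exact (pow_dvd_pow X m.le_succ).trans (h m i₀)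
    classical
    let v := Nat.find hex
    have hv : ∀ i, X ^ v ∣ b i := by
      intro i
      rcases hv : v with _ | k
      · simp
      · have := Nat.find_min hex (m := k) (by omega)
        push Not at this
        exact this i
    obtain ⟨d, hd⟩ := hb (v + 1)
    obtain ⟨i₁, hi₁⟩ := Nat.find_spec hex
    let n := Nat.findGreatest (fun i => ¬ X ^ (v + 1) ∣ b i) d
    have hi₁d : i₁ ≤ d := by
      by_contra! h
      exact hi₁ (hd i₁ h.le)
    refine H n v b hb hv (Nat.findGreatest_spec (P := fun i => ¬ X ^ (v + 1) ∣ b i) hi₁d hi₁)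
      fun i hi => ?_
    by_cases hid : i ≤ d
    · exact not_not.1 (Nat.findGreatest_is_greatest hi hid)
    · exact hd i (by omega)
  intro n
  induction n with
  | zero =>
    intro v b hb hbv hn hgt
    convert Set.finite_empty
    ext z
    simp only [Set.mem_ofPred_eq, Set.mem_empty_iff_false, iff_false]
    intro hz
    obtain ⟨y, hy⟩ := (hb.shift 1).exists_evalsTo z
    -- A zero would give `b 0 = -z * y` with `X ^ (v + 1) ∣ y`, against the choice of `n = 0`.
    have h1 := hz.eq_add hy
    have h2 : X ^ (v + 1) ∣ y := hy.dvd fun i => hgt _ (by omega)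
    refine hn ?_
    rw [eq_neg_of_add_eq_zero_left h1.symm]
    exact (h2.mul_left z).neg_right
  | succ n ih =>
    intro v b hb hbv hn hgt
    rcases Set.eq_empty_or_nonempty {z | EvalsTo b z 0} with h | ⟨z, hz⟩
    · rw [h]; exact Set.finite_empty
    choose g hg using fun j => (hb.shift (j + 1)).exists_evalsTo z
    have hg0 : CoeffsTendToZero g := fun m => by
      obtain ⟨d, hd⟩ := hb m
      exact ⟨d, fun j hj => (hg j).dvd fun i => hd _ (by omega)⟩
    have hgn : ∀ j, n < j → X ^ (v + 1) ∣ g j := fun j hj => (hg j).dvd fun i => hgt _ (by omega)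
    have hfin := ih v g hg0 (fun j => (hg j).dvd fun i => hbv _) (fun h => hn ?_) hgn
    · refine (hfin.insert z).subset fun w hw => ?_
      obtain ⟨u, hu⟩ := hg0.exists_evalsTo w
      have h := EvalsTo.sub_eq_mul hz hw hg hu hg0
      rw [sub_zero, eq_comm, mul_eq_zero, sub_eq_zero] at h
      rcases h with h | rfl
      · exact Or.inl h
      · exact Or.inr hu
    -- Since `g n = b (n + 1) + z * y` with `X ^ (v + 1) ∣ y`, the quotient attains order `v` at
    -- `n`, so its last such index is one lower.
    · obtain ⟨y, hy⟩ := (hb.shift (n + 1 + 1)).exists_evalsTo z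
      have h1 := (hg n).eq_add (y' := y) (by simpa only [← add_assoc] using hy)
      have h2 : X ^ (v + 1) ∣ y := hy.dvd fun i => hgt _ (by omega)
      have h3 := h.sub (h2.mul_left z)
      rwa [h1, add_sub_cancel_right] at h3

end PowerSeries

/-! ### The falling factorial series and an automorphism moving it -/

/-- The coefficients of `∑ n, c n * X ^ n * (x)_(deg n)` as a power series in `x`, where `(x)_k`
is the falling factorial. -/
noncomputable def fallingSeries (c : ℕ → ℂ) (deg : ℕ → ℕ) (j : ℕ) : ℂ⟦X⟧ :=
  mk fun n => c n * ((descPochhammer ℤ (deg n)).coeff j : ℂ)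

theorem coeffsTendToZero_fallingSeries (c : ℕ → ℂ) {deg : ℕ → ℕ} (hdeg : StrictMono deg) :
    CoeffsTendToZero (fallingSeries c deg) := by
  refine fun m => ⟨deg m, fun i hi => X_pow_dvd_iff.2 fun n hn => ?_⟩
  rw [fallingSeries, coeff_mk, Polynomial.coeff_eq_zero_of_natDegree_lt]
  · simp
  · rw [descPochhammer_natDegree]
    exact (hdeg hn).trans_le hi

/-- A natural number is a constant series, so each coefficient in `X` can be evaluated separately,
as a polynomial in `s`. -/
theorem evalsTo_fallingSeries_natCast (c : ℕ → ℂ) {deg : ℕ → ℕ} (hdeg : StrictMono deg) (s : ℕ) :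
    EvalsTo (fallingSeries c deg) (s : ℂ⟦X⟧)
      (mk fun n => c n * (((descPochhammer ℤ (deg n)).eval (s : ℤ) : ℤ) : ℂ)) := by
  refine fun m => ⟨deg m, fun d hd => X_pow_dvd_iff.2 fun n hn => ?_⟩
  have hs (i : ℕ) : (s : ℂ⟦X⟧) ^ i = C ((s : ℂ) ^ i) := by simp
  simp only [map_sub, map_sum, coeff_mk, hs, coeff_mul_C, fallingSeries]
  rw [Polynomial.eval_eq_sum_range' (n := d)]
  · push_cast
    rw [Finset.mul_sum, sub_eq_zero]
    exact Finset.sum_congr rfl fun i _ => by ring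
  · rw [descPochhammer_natDegree]
    exact (hdeg hn).trans_le hd

theorem coeffDerivation_fallingSeries {c : ℕ → ℂ} {d : ℕ → Derivation ℚ ℂ ℂ}
    (hd : ∀ m k, d m (c k) = if m = k then 1 else 0) (deg : ℕ → ℕ) (m j : ℕ) :
    coeffDerivation (d m) (fallingSeries c deg j) =
      monomial m ((descPochhammer ℤ (deg m)).coeff j : ℂ) := by
  ext n
  rw [coeff_coeffDerivation, fallingSeries, coeff_mk, Derivation.leibniz, Derivation.map_intCast,
    hd, coeff_monomial]
  rcases eq_or_ne m n with rfl | h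
  · simp
  · simp [h, h.symm]

/-- Finitely many power series can be fixed by an automorphism that moves `fallingSeries`. -/
theorem exists_ringEquiv_fixing_ne {c : ℕ → ℂ} {d : ℕ → Derivation ℚ ℂ ℂ}
    (hd : ∀ m k, d m (c k) = if m = k then 1 else 0) {deg : ℕ → ℕ} (hdeg : StrictMono deg)
    (S : Finset ℂ⟦X⟧) :
    ∃ σ : ℂ⟦X⟧ ≃+* ℂ⟦X⟧, σ X = X ∧ (∀ x ∈ S, σ x = x) ∧
      ∃ j, σ (fallingSeries c deg j) ≠ fallingSeries c deg j := by
  let a (i : Fin #S) : ℂ⟦X⟧ := (S.equivFin.symm i : ℂ⟦X⟧)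
  let M : Matrix (Fin #S) (Fin (#S + 1)) ℂ⟦X⟧ := fun i m => coeffDerivation (d m) (a i)
  -- There are `#S` linear equations in `#S + 1` unknowns.
  obtain ⟨l, hl, hl0⟩ : ∃ l, M.mulVecLin l = 0 ∧ l ≠ 0 := by
    by_contra! h
    have := le_of_fin_injective _ M.mulVecLin
      ((injective_iff_map_eq_zero _).2 h)
    omega
  let D : Derivation ℚ ℂ⟦X⟧ ℂ⟦X⟧ := (X : ℂ⟦X⟧) • ∑ m, l m • coeffDerivation (d m)
  have hDapply (x : ℂ⟦X⟧) : D x = X * ∑ m, l m * coeffDerivation (d m) x := by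
    simp only [D, Derivation.smul_apply, smul_eq_mul]
    congr 1
    rw [← Derivation.coeFnAddMonoidHom_apply, map_sum, Finset.sum_apply]
    rfl
  have hDX : D X = 0 := by simp [hDapply]
  have hD (n : ℕ) (x : ℂ⟦X⟧) (hx : X ^ n ∣ x) : X ^ (n + 1) ∣ D x := by
    obtain ⟨y, rfl⟩ := hx
    rw [Derivation.leibniz, Derivation.leibniz_pow, hDX, smul_zero, smul_zero, smul_zero,
      add_zero, hDapply, smul_eq_mul, ← mul_assoc, ← pow_succ]
    exact dvd_mul_right _ _
  refine ⟨expDerivationEquiv hD, expDerivation_eq_self hDX, fun x hx => ?_, ?_⟩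
  · refine expDerivation_eq_self ?_
    have h := congrFun hl (S.equivFin ⟨x, hx⟩)
    rw [Matrix.mulVecLin_apply] at h
    simp only [Matrix.mulVec, dotProduct, M, a, Equiv.symm_apply_apply, Pi.zero_apply] at h
    rw [hDapply]
    simp only [mul_comm (l _), h, mul_zero]
  · obtain ⟨k, hk, hmax⟩ : ∃ k, l k ≠ 0 ∧ ∀ m, k < m → l m = 0 := by
      classical
      have hne : (univ.filter fun m => l m ≠ 0).Nonempty := by
        have ⟨m, hm⟩ := Function.ne_iff.1 hl0
        exact ⟨m, by simpa using hm⟩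
      refine ⟨_, (Finset.mem_filter.1 (Finset.max'_mem _ hne)).2, fun m hm => ?_⟩
      by_contra h
      exact absurd (Finset.le_max' _ m (by simpa using h)) (not_le.2 hm)
    -- In the coefficient of `x ^ deg k`, indices `m < k` contribute nothing by degree and `m > k`
    -- by maximality of `k`. Monicity leaves `D (b (deg k)) = X * l k * X ^ k`, which is nonzero.
    refine ⟨deg k, fun h => ?_⟩
    have h0 := derivation_eq_zero_of_expDerivation_eq_self hD h
    rw [hDapply, Finset.sum_eq_single k, coeffDerivation_fallingSeries hd] at h0
    · have h1 : (descPochhammer ℤ (deg k)).coeff (deg k) = 1 := by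
        have := monic_descPochhammer ℤ (deg k)
        rwa [Polynomial.Monic, Polynomial.leadingCoeff, descPochhammer_natDegree] at this
      rw [h1, Int.cast_one, ← X_pow_eq] at h0
      simp [hk, X_ne_zero] at h0
    · intro m _ hm
      rcases lt_or_gt_of_ne hm with h2 | h2
      · rw [coeffDerivation_fallingSeries hd, Polynomial.coeff_eq_zero_of_natDegree_lt]
        · simp
        · rw [descPochhammer_natDegree]
          exact hdeg h2
      · rw [hmax m h2, zero_mul]
    · simp

/-! ### The topology of `K` and infinitude of sets of local dimension 1 -/

namespace LaurentCounting

open FirstOrder Language Topology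

theorem ofPowerSeries_mem_OK (z : ℂ⟦X⟧) : HahnSeries.ofPowerSeries ℤ ℂ z ∈ OK := ⟨z, rfl⟩

theorem ofPowerSeries_injective' :
    Function.Injective (HahnSeries.ofPowerSeries ℤ ℂ : ℂ⟦X⟧ → K) :=
  HahnSeries.ofPowerSeries_injective

theorem exists_dvd_imp_mem_of_mem_nhds {x : K} {s : Set K} (hs : s ∈ 𝓝 x) :
    ∃ m : ℕ, ∀ f : ℂ⟦X⟧, X ^ m ∣ f → x + HahnSeries.ofPowerSeries ℤ ℂ f ∈ s := by
  obtain ⟨γ, hγ⟩ := Valued.mem_nhds.1 hs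
  have hX : Valued.v (HahnSeries.ofPowerSeries ℤ ℂ X : K) ≤ WithZero.exp (-1 : ℤ) := by
    have := LaurentSeries.valuation_X_pow ℂ 1
    simpa using this.le
  have ht := Valued.tendsto_zero_pow_of_le_exp_neg_one hX
  have hmem : {y : K | Valued.v.restrict (y - 0) < γ.1} ∈ 𝓝 (0 : K) :=
    Valued.mem_nhds.2 ⟨γ, subset_rfl⟩
  obtain ⟨m, hm⟩ := (ht.eventually hmem).exists
  refine ⟨m, ?_⟩
  rintro _ ⟨f, rfl⟩
  apply hγ
  have hm' : Valued.v.restrict ((HahnSeries.ofPowerSeries ℤ ℂ X : K) ^ m - 0) < γ.1 := hm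
  rw [sub_zero] at hm'
  change Valued.v.restrict _ < γ.1
  rw [add_sub_cancel_left, map_mul, map_pow, map_mul]
  refine lt_of_le_of_lt ?_ hm'
  refine mul_le_of_le_one_right' ?_
  rw [Valuation.restrict_le_one_iff]
  rw [LaurentSeries.valuation_def, ← LaurentSeries.coe_algebraMap]
  exact (PowerSeries.idealX ℂ).valuation_le_one f

theorem infinite_of_mem_nhds_K {x : Fin 1 → K} {s : Set (Fin 1 → K)} (hs : s ∈ 𝓝 x) :
    s.Infinite := by
  have hc : ContinuousAt (fun y : K => (fun _ : Fin 1 => y)) (x 0) :=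
    (continuous_pi fun _ => continuous_id).continuousAt
  have hx : (fun _ : Fin 1 => x 0) = x := by
    ext i; rw [Subsingleton.elim i 0]
  have h : (fun y : K => (fun _ : Fin 1 => y)) ⁻¹' s ∈ 𝓝 (x 0) := hc (by
    change s ∈ 𝓝 fun _ : Fin 1 => x 0
    rwa [hx])
  obtain ⟨m, hm⟩ := exists_dvd_imp_mem_of_mem_nhds h
  refine Set.infinite_of_injective_forall_mem
    (f := fun k : ℕ => fun _ : Fin 1 => x 0 + HahnSeries.ofPowerSeries ℤ ℂ (X ^ m * C (k : ℂ)))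
    (fun k l hkl => ?_) fun k => hm _ (dvd_mul_right _ _)
  have h1 := ofPowerSeries_injective' (add_left_cancel (congrFun hkl 0))
  exact Nat.cast_injective (C_injective (mul_left_cancel₀ (pow_ne_zero m X_ne_zero) h1))

/-- A function on a finite set has finite range, while nonempty open subsets of `K` are infinite. -/
theorem HasLocalDim.infinite {n : ℕ} {C : Set (Fin n → K)} {x : Fin n → K}
    (h : HasLocalDim C x 1) : C.Infinite := by
  obtain ⟨U, hUo, hxU, hU, H⟩ := h.1
  obtain ⟨g, -, y, hy⟩ := H U subset_rfl hUo hxU hU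
  intro hC
  have : Finite ↥(U ∩ C) := (hC.subset Set.inter_subset_right).to_subtype
  exact infinite_of_mem_nhds_K (mem_interior_iff_mem_nhds.1 hy) (Set.finite_range g)

/-! ### Evaluation of restricted series in one variable -/

/-- The restricted power series in one variable with given coefficients. -/
def RestrictedSeries.ofCoeffs (b : ℕ → ℂ⟦X⟧) (hb : CoeffsTendToZero b) : RestrictedSeries 1 :=
  ⟨fun i => b (i 0), fun m => by
    obtain ⟨d, hd⟩ := hb m
    refine ⟨d, fun i hi => hd _ ?_⟩
    rwa [Finsupp.degree_eq_sum, Fin.sum_univ_one] at hi⟩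

/-- All but finitely many terms are divisible by `X ^ m`, so convergence of the initial partial sums
upgrades to unconditional summation. -/
theorem hasSum_of_evalsTo {b : ℕ → ℂ⟦X⟧} (hb : CoeffsTendToZero b) {z y : ℂ⟦X⟧}
    (h : EvalsTo b z y) :
    HasSum (fun i => HahnSeries.ofPowerSeries ℤ ℂ (b i * z ^ i) : ℕ → K)
      (HahnSeries.ofPowerSeries ℤ ℂ y) := by
  intro s hs
  obtain ⟨m, hm⟩ := exists_dvd_imp_mem_of_mem_nhds hs
  obtain ⟨d, hd⟩ := hb m
  obtain ⟨e, he⟩ := h m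
  refine Filter.mem_map.2 (Filter.mem_atTop_sets.2 ⟨range (max d e), fun T hT => ?_⟩)
  have h1 : X ^ m ∣ ∑ i ∈ T, b i * z ^ i - y := by
    have h2 : X ^ m ∣ ∑ i ∈ T \ range (max d e), b i * z ^ i :=
      Finset.dvd_sum fun i hi => (hd i (by simp at hi; omega)).mul_right _
    have h3 := h2.sub (he (max d e) (le_max_right _ _))
    rw [← Finset.sum_sdiff hT]
    convert h3 using 1
    ring
  have h4 := hm _ h1
  rwa [← map_add, add_sub_cancel, map_sum] at h4

theorem RestrictedSeries.fn_ofCoeffs {b : ℕ → ℂ⟦X⟧} (hb : CoeffsTendToZero b) {z y : ℂ⟦X⟧}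
    (h : EvalsTo b z y) :
    (RestrictedSeries.ofCoeffs b hb).fn ![HahnSeries.ofPowerSeries ℤ ℂ z] =
      HahnSeries.ofPowerSeries ℤ ℂ y := by
  have hOK : ∀ j, ![HahnSeries.ofPowerSeries ℤ ℂ z] j ∈ OK := fun j => by
    rw [Subsingleton.elim j 0]
    exact ofPowerSeries_mem_OK z
  rw [RestrictedSeries.fn, if_pos hOK]
  refine HasSum.tsum_eq ?_
  rw [← (Finsupp.uniqueEquiv (M := ℕ) (0 : Fin 1)).symm.hasSum_iff]
  convert hasSum_of_evalsTo hb h using 2 with i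
  have h1 : (Finsupp.uniqueEquiv (M := ℕ) (0 : Fin 1)).symm i 0 = i :=
    (Finsupp.uniqueEquiv (M := ℕ) (0 : Fin 1)).apply_symm_apply i
  have h2 : (RestrictedSeries.ofCoeffs b hb).coeffK
      ((Finsupp.uniqueEquiv (M := ℕ) (0 : Fin 1)).symm i) =
      HahnSeries.ofPowerSeries ℤ ℂ (b i) := by
    conv_rhs => rw [← h1]
    rfl
  rw [Function.comp_apply, Fin.prod_univ_one, h1, h2, map_mul, map_pow]
  rfl

/-! ### Automorphisms and definable sets -/

/-- The automorphism of `K` induced by an automorphism of `ℂ⟦X⟧`. -/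
noncomputable def fieldAut (σ : ℂ⟦X⟧ ≃+* ℂ⟦X⟧) : K ≃+* K := IsFractionRing.ringEquivOfRingEquiv σ

theorem fieldAut_ofPowerSeries (σ : ℂ⟦X⟧ ≃+* ℂ⟦X⟧) (z : ℂ⟦X⟧) :
    fieldAut σ (HahnSeries.ofPowerSeries ℤ ℂ z) = HahnSeries.ofPowerSeries ℤ ℂ (σ z) :=
  IsFractionRing.ringEquivOfRingEquiv_algebraMap σ z

theorem fieldAut_symm (σ : ℂ⟦X⟧ ≃+* ℂ⟦X⟧) : (fieldAut σ).symm = fieldAut σ.symm := rfl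

theorem fieldAut_mem_OK (σ : ℂ⟦X⟧ ≃+* ℂ⟦X⟧) {x : K} : fieldAut σ x ∈ OK ↔ x ∈ OK := by
  have h (σ : ℂ⟦X⟧ ≃+* ℂ⟦X⟧) (x : K) (hx : x ∈ OK) : fieldAut σ x ∈ OK := by
    obtain ⟨z, rfl⟩ := hx
    exact ⟨σ z, (fieldAut_ofPowerSeries σ z).symm⟩
  refine ⟨fun hx => ?_, h σ x⟩
  have := h σ.symm _ hx
  rwa [← fieldAut_symm, RingEquiv.symm_apply_apply] at this

/-- `fieldAut σ` is an automorphism of the valued field `K`. -/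
noncomputable def valuedFieldAut (σ : ℂ⟦X⟧ ≃+* ℂ⟦X⟧) : valuedFieldLang.Equiv K K where
  toEquiv := (fieldAut σ).toEquiv
  map_fun' f v := by
    cases f
    · exact map_add (fieldAut σ) _ _
    · exact map_sub (fieldAut σ) _ _
    · exact map_mul (fieldAut σ) _ _
    · exact map_inv₀ (fieldAut σ) _
  map_rel' R v := by
    cases R
    change (fieldAut σ (v 0) ≠ 0 ∧ fieldAut σ (v 1) / fieldAut σ (v 0) ∈ OK) ↔
      (v 0 ≠ 0 ∧ v 1 / v 0 ∈ OK)
    rw [← map_div₀, fieldAut_mem_OK, map_ne_zero]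

/-- A semi-algebraic set is invariant under the automorphisms that fix finitely many elements. -/
theorem IsSemialgebraic.exists_finset_invariant {ι : Type} {C : Set (ι → K)}
    (hC : IsSemialgebraic C) : ∃ S : Finset ℂ⟦X⟧, ∀ σ : ℂ⟦X⟧ ≃+* ℂ⟦X⟧, (∀ x ∈ S, σ x = x) →
      ∀ v ∈ C, fieldAut σ ∘ v ∈ C := by
  classical
  obtain ⟨A, -, hA⟩ := Set.definable_iff_finitely_definable.1 hC
  obtain ⟨φ, rfl⟩ := Set.definable_iff_exists_formula_sum.1 hA
  have hfrac (x : K) : ∃ p : ℂ⟦X⟧ × ℂ⟦X⟧,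
      HahnSeries.ofPowerSeries ℤ ℂ p.1 / HahnSeries.ofPowerSeries ℤ ℂ p.2 = x := by
    obtain ⟨p, q, -, h⟩ := IsFractionRing.div_surjective (A := ℂ⟦X⟧) x
    exact ⟨(p, q), h⟩
  choose p hp using hfrac
  -- Numerators and denominators of the parameters of a defining formula.
  refine ⟨A.image (fun x => (p x).1) ∪ A.image fun x => (p x).2, fun σ hσ v hv => ?_⟩
  have hfix (x : K) (hx : x ∈ A) : fieldAut σ x = x := by
    rw [← hp x, map_div₀, fieldAut_ofPowerSeries, fieldAut_ofPowerSeries,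
      hσ _ (mem_union_left _ (mem_image_of_mem _ hx)),
      hσ _ (mem_union_right _ (mem_image_of_mem _ hx))]
  have hv' : φ.Realize (Sum.elim (↑) v) := hv
  have h := (StrongHomClass.realize_formula (valuedFieldAut σ) φ).2 hv'
  change φ.Realize _
  convert h using 1
  funext i
  rcases i with x | i
  · exact (hfix x.1 x.2).symm
  · rfl

/-! ### Definability of the graph -/

theorem isAnalyticDefinable_graph (F : RestrictedSeries 1) :
    IsAnalyticDefinable {v : Fin 2 → K | v 0 ∈ OK ∧ v 1 = F.fn ![v 0]} := by
  let x : analyticLang.Term (Fin 2) := Term.var 0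
  let y : analyticLang.Term (Fin 2) := Term.var 1
  let sub : analyticLang.Functions 2 := Sum.inl ValuedFieldFunc.sub
  let mul : analyticLang.Functions 2 := Sum.inl ValuedFieldFunc.mul
  let inv : analyticLang.Functions 1 := Sum.inl ValuedFieldFunc.inv
  let dvd : analyticLang.Relations 2 := Sum.inl ValuedFieldRel.dvd
  let G : analyticLang.Functions 1 := Sum.inr F
  -- The language has no constants 0 and 1: `x = x - x` says `x = 0`, and `x * x⁻¹` is 1 otherwise,
  -- so the disjunction says `x ∈ OK`.
  let φ : analyticLang.Formula (Fin 2) :=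
    (x.equal (sub.apply₂ x x) ⊔ dvd.formula₂ (mul.apply₂ x (inv.apply₁ x)) x) ⊓
      y.equal (G.apply₁ x)
  refine Set.empty_definable_iff.2 ⟨φ, ?_⟩
  ext v
  change _ ↔ φ.Realize v
  have hsub (a b : K) : Structure.funMap sub ![a, b] = a - b := rfl
  have hmul (a b : K) : Structure.funMap mul ![a, b] = a * b := rfl
  have hinv (a : K) : Structure.funMap inv ![a] = a⁻¹ := rfl
  have hG (a : K) : Structure.funMap G ![a] = F.fn ![a] := rfl
  have hdvd (a b : K) : Structure.RelMap dvd ![a, b] ↔ a ≠ 0 ∧ b / a ∈ OK := Iff.rfl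
  simp only [φ, x, y, Formula.realize_inf, Formula.realize_sup, Formula.realize_equal,
    Formula.realize_rel₂, Term.realize_functions_apply₁, Term.realize_functions_apply₂,
    Term.realize_var, hsub, hmul, hinv, hG, hdvd, sub_self]
  refine and_congr_left' ?_
  by_cases h : v 0 = 0
  · simp [h, OK.zero_mem]
  · simp [h]

end LaurentCounting

/-! ### Emptiness of the algebraic part and the count of points -/

namespace LaurentCounting

/-- The algebraic part of the graph of a restricted series is empty if any finitely many power
series can be fixed by an automorphism that does not preserve the series. -/
theorem algPart_eq_empty {b : ℕ → ℂ⟦X⟧} (hb : CoeffsTendToZero b)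
    (hmove : ∀ S : Finset ℂ⟦X⟧, ∃ σ : ℂ⟦X⟧ ≃+* ℂ⟦X⟧, σ X = X ∧ (∀ x ∈ S, σ x = x) ∧
      ∃ j, σ (b j) ≠ b j)
    {X : Set (Fin 2 → K)}
    (hX : X = {v | v 0 ∈ OK ∧ v 1 = (RestrictedSeries.ofCoeffs b hb).fn ![v 0]}) :
    algPart X = ∅ := by
  rw [Set.eq_empty_iff_forall_notMem]
  rintro v ⟨C, ⟨hCX, hC, hdim⟩, hv⟩
  have hinf := (hdim v hv).infinite
  obtain ⟨S, hS⟩ := hC.exists_finset_invariant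
  obtain ⟨σ, hσX, hσS, j, hj⟩ := hmove S
  have hfin := finite_zeros_of_coeffsTendToZero ((hb.map σ hσX).sub hb)
    ⟨j, sub_ne_zero.2 hj⟩
  have hgraph : ∀ v ∈ X, ∃ z y, EvalsTo b z y ∧
      v 0 = HahnSeries.ofPowerSeries ℤ ℂ z ∧ v 1 = HahnSeries.ofPowerSeries ℤ ℂ y := by
    intro v hv
    rw [hX] at hv
    obtain ⟨⟨z, hz⟩, h1⟩ := hv
    obtain ⟨y, hy⟩ := hb.exists_evalsTo z
    exact ⟨z, y, hy, hz.symm, by rw [h1, ← hz, RestrictedSeries.fn_ofCoeffs hb hy]⟩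
  refine hinf (((hfin.image fun w => (![HahnSeries.ofPowerSeries ℤ ℂ (σ.symm w),
    (RestrictedSeries.ofCoeffs b hb).fn ![HahnSeries.ofPowerSeries ℤ ℂ (σ.symm w)]] :
      Fin 2 → K))).subset fun v hv => ?_)
  obtain ⟨z, y, hzy, hz, hy⟩ := hgraph v (hCX hv)
  -- The image of `v` under `σ` lies in `C ⊆ X`, so `σ y` is the value at `σ z` both of `b` and of
  -- its `σ`-conjugate; `σ z` is a zero of their difference.
  obtain ⟨z', y', hzy', hz', hy'⟩ := hgraph _ (hCX (hS σ hσS v hv))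
  rw [Function.comp_apply, hz, fieldAut_ofPowerSeries] at hz'
  rw [Function.comp_apply, hy, fieldAut_ofPowerSeries] at hy'
  rw [← ofPowerSeries_injective' hz', ← ofPowerSeries_injective' hy'] at hzy'
  refine ⟨σ z, ?_, ?_⟩
  · have := (hzy.map σ hσX).sub hzy'
    rwa [sub_self] at this
  · funext i
    beta_reduce
    rw [σ.symm_apply_apply, RestrictedSeries.fn_ofCoeffs hb hzy]
    fin_cases i
    · exact hz.symm
    · exact hy.symm

/-- The value of `fallingSeries` at a natural number `s < deg r` is a polynomial of degree less
than `r`. -/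
theorem fn_fallingSeries_natCast_mem_polyLT (c : ℕ → ℂ) {deg : ℕ → ℕ} (hdeg : StrictMono deg)
    {s r : ℕ} (hs : s < deg r) :
    (RestrictedSeries.ofCoeffs _ (coeffsTendToZero_fallingSeries c hdeg)).fn
      ![HahnSeries.ofPowerSeries ℤ ℂ (s : ℂ⟦X⟧)] ∈ polyLT r := by
  rw [RestrictedSeries.fn_ofCoeffs _ (evalsTo_fallingSeries_natCast c hdeg s)]
  set y : ℂ⟦X⟧ := PowerSeries.mk fun n =>
    c n * (((descPochhammer ℤ (deg n)).eval (s : ℤ) : ℤ) : ℂ) with hy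
  refine ⟨y.trunc r, PowerSeries.degree_trunc_lt y r, ?_⟩
  congr 1
  ext n
  rw [Polynomial.coeff_coe, PowerSeries.coeff_trunc]
  split_ifs with h
  · rfl
  · rw [hy, coeff_mk, descPochhammer_eval_coe_nat_of_lt (hs.trans_le (hdeg.monotone (not_lt.1 h)))]
    simp

theorem natCast_mem_polyLT (s : ℕ) {r : ℕ} (hr : 0 < r) :
    HahnSeries.ofPowerSeries ℤ ℂ (s : ℂ⟦X⟧) ∈ polyLT r := by
  refine ⟨Polynomial.C (s : ℂ), Polynomial.degree_C_le.trans_lt (by exact_mod_cast hr), ?_⟩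
  rw [Polynomial.coe_C, map_natCast (C (R := ℂ))]

end LaurentCounting

theorem proposition2p2 (N : ℕ → ℕ) :
    ∃ X : Set (Fin 2 → LaurentCounting.K),
      LaurentCounting.IsAnalyticDefinable X ∧
      (∀ r : ℕ, 0 < r →
        (N r : ℕ∞) < (LaurentCounting.pointsLT (LaurentCounting.transPart X) r).encard) ∧
      ∃ (F : LaurentCounting.RestrictedSeries 1) (f : LaurentCounting.OK → LaurentCounting.OK),
        (∀ x : LaurentCounting.OK, (f x : LaurentCounting.K) = F.fn ![(x : LaurentCounting.K)]) ∧
        X = {v | ∃ x : LaurentCounting.OK,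
          v = ![(x : LaurentCounting.K), (f x : LaurentCounting.K)]} := by
  obtain ⟨c, d, hd⟩ := exists_dual_derivations
  -- Partial sums of `N k + 1` increase strictly and exceed `N m`.
  let deg (m : ℕ) : ℕ := ∑ k ∈ range (m + 1), (N k + 1)
  have hdeg : StrictMono deg := strictMono_nat_of_lt_succ fun m => by
    simp only [deg, Finset.sum_range_succ _ (m + 1)]
    omega
  have hN (r : ℕ) : N r < deg r := by
    simp only [deg, Finset.sum_range_succ]
    omega
  have hb := coeffsTendToZero_fallingSeries c hdeg
  let F := LaurentCounting.RestrictedSeries.ofCoeffs _ hb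
  let X : Set (Fin 2 → LaurentCounting.K) := {v | v 0 ∈ LaurentCounting.OK ∧ v 1 = F.fn ![v 0]}
  have htrans : LaurentCounting.transPart X = X := by
    rw [LaurentCounting.transPart,
      LaurentCounting.algPart_eq_empty hb (exists_ringEquiv_fixing_ne hd hdeg) rfl, Set.sdiff_empty]
  have hF (x : LaurentCounting.OK) : F.fn ![(x : LaurentCounting.K)] ∈ LaurentCounting.OK := by
    obtain ⟨_, z, rfl⟩ := x
    obtain ⟨y, hy⟩ := hb.exists_evalsTo z
    exact ⟨y, (LaurentCounting.RestrictedSeries.fn_ofCoeffs hb hy).symm⟩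
  refine ⟨X, LaurentCounting.isAnalyticDefinable_graph F, fun r hr => ?_, F,
    fun x => ⟨_, hF x⟩, fun x => rfl, ?_⟩
  · rw [htrans]
    let P (s : ℕ) : Fin 2 → LaurentCounting.K := ![HahnSeries.ofPowerSeries ℤ ℂ (s : ℂ⟦X⟧),
      F.fn ![HahnSeries.ofPowerSeries ℤ ℂ (s : ℂ⟦X⟧)]]
    have hP : Function.Injective P := fun s s' h => by
      have h1 := LaurentCounting.ofPowerSeries_injective' (congrFun h 0)
      have h2 := congrArg (PowerSeries.constantCoeff (R := ℂ)) h1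
      simpa using h2
    have hsub : P '' (range (deg r) : Set ℕ) ⊆ LaurentCounting.pointsLT X r := by
      rintro _ ⟨s, hs, rfl⟩
      refine ⟨⟨LaurentCounting.ofPowerSeries_mem_OK _, rfl⟩, fun i => ?_⟩
      fin_cases i
      · exact LaurentCounting.natCast_mem_polyLT s hr
      · exact LaurentCounting.fn_fallingSeries_natCast_mem_polyLT c hdeg (by simpa using hs)
    refine lt_of_lt_of_le ?_ (Set.encard_le_encard hsub)
    rw [hP.encard_image, Set.encard_coe_eq_coe_finsetCard, card_range]
    exact_mod_cast hN r
  · ext v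
    constructor
    · rintro ⟨h0, h1⟩
      refine ⟨⟨v 0, h0⟩, ?_⟩
      funext i
      fin_cases i
      · rfl
      · exact h1
    · rintro ⟨x, rfl⟩
      exact ⟨x.2, rfl⟩
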